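/- For $j\in\mathbb Z$ let $\epsilon(j)=1$ if $j$ is even and $\epsilon(j)=-1$ if $j$ is odd. The Manhattan lattice is the directed graph with vertex set $\mathbb Z^2$ in which exactly two edges go out of each vertex $x=(x^1,x^2)$: one to $(x^1+\epsilon(x^2),x^2)$ and one to $(x^1,x^2+\epsilon(x^1))$. The standard random walk $(X_n)_{n\ge 0}$ on the Manhattan lattice is the Markov chain on $\mathbb Z^2$ that at each step follows one of the two outgoing edges of its current position, each with probability $1/2$. Write $P_x$, $E_x$ for probability and expectation when $X_0=x$. Then: 1. (CLT with zero asymptotic velocity) There are constants $C_2>C_1>0$ such that $C_1 n\le E_x\big(|X_n-X_0|^2\big)\le C_2 n$ for all $x\in\mathbb Z^2$ and $n\ge 0$; and there is a centered Gaussian measure $\gamma$ on $\mathbb R^2$ with positive definite covariance matrix such that, for every $x\in\mathbb Z^2$, the law of $X_n/\sqrt n$ under $P_x$ converges weakly to $\gamma$ as $n\to\infty$. 2. (Recurrence) For every $x\in\mathbb Z^2$, $P_x\{X_n=x=X_0 \text{ for some } n>0\}=1$. 3. Let $\varphi(x^1,x^2)=(\lfloor x^1/2\rfloor,\lfloor x^2/2\rfloor)$.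 Under $P_{(0,0)}$ the process $Y_n=\varphi(X_{2n})$, $n\ge0$, is the standard nearest-neighbor random walk on $\mathbb Z^2$ started at $(0,0)$ (each step goes to one of the four nearest neighbors with probability $1/4$). -/

import Mathlib

open MeasureTheory ProbabilityTheory Filter
open scoped ENNReal Topology

noncomputable section

/-- The direction sign `ε(j)`: `1` for even `j`, `-1` for odd `j`. -/
def dirSign (j : ℤ) : ℤ := if Even j then 1 else -1

/-- The Manhattan lattice: the directed graph on `ℤ²` with the edges
`(x₁, x₂) → (x₁ + ε(x₂), x₂)` and `(x₁, x₂) → (x₁, x₂ + ε(x₁))`. -/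
def manhattanLattice : Digraph (ℤ × ℤ) where
  Adj x y := y = (x.1 + dirSign x.2, x.2) ∨ y = (x.1, x.2 + dirSign x.1)

lemma dirSign_ne_zero (j : ℤ) : dirSign j ≠ 0 := by
  unfold dirSign; split_ifs <;> norm_num

open Classical in
/-- One step of the standard walk on the Manhattan lattice: each of the two edges going out of `x`
is followed with probability `1/2`. -/
def manhattanStep (x : ℤ × ℤ) : PMF (ℤ × ℤ) :=
  ⟨fun y => if manhattanLattice.Adj x y then 1 / 2 else 0, by
    have hne : (x.1 + dirSign x.2, x.2) ≠ (x.1, x.2 + dirSign x.1) := by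
      intro h
      exact dirSign_ne_zero x.2 (by simpa using congrArg Prod.fst h)
    have h := hasSum_sum_of_ne_finset_zero (L := SummationFilter.unconditional _)
      (f := fun y => if manhattanLattice.Adj x y then (1 / 2 : ℝ≥0∞) else 0)
      (s := {(x.1 + dirSign x.2, x.2), (x.1, x.2 + dirSign x.1)}) (by
        intro y hy
        simp only [Finset.mem_insert, Finset.mem_singleton] at hy
        exact if_neg hy)
    rw [Finset.sum_pair hne] at h
    simpa [manhattanLattice, ENNReal.inv_two_add_inv_two] using h⟩

/-- One step of the standard nearest-neighbour walk on `ℤ²`: each of the four points at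
distance `1` from `x` is reached with probability `1/4`. -/
def simpleStep (x : ℤ × ℤ) : PMF (ℤ × ℤ) :=
  ⟨fun y => if |y.1 - x.1| + |y.2 - x.2| = 1 then 1 / 4 else 0, by
    have h := hasSum_sum_of_ne_finset_zero (L := SummationFilter.unconditional _)
      (f := fun y : ℤ × ℤ => if |y.1 - x.1| + |y.2 - x.2| = 1 then (1 / 4 : ℝ≥0∞) else 0)
      (s := {(x.1 + 1, x.2), (x.1 - 1, x.2), (x.1, x.2 + 1), (x.1, x.2 - 1)}) (by
        rintro ⟨a, b⟩ hy
        simp only [Finset.mem_insert, Finset.mem_singleton, Prod.mk.injEq] at hy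
        refine if_neg ?_
        intro h
        apply hy
        simp only at h
        rcases abs_cases (a - x.1) with h1 | h1 <;> rcases abs_cases (b - x.2) with h2 | h2 <;>
          omega)
    have e : (4 : ℝ≥0∞)⁻¹ + (4⁻¹ + (4⁻¹ + 4⁻¹)) = 1 := by
      have : (4 : ℝ≥0∞)⁻¹ + (4⁻¹ + (4⁻¹ + 4⁻¹)) = 4 * 4⁻¹ := by ring
      rw [this, ENNReal.mul_inv_cancel (by norm_num) (by norm_num)]
    rw [Finset.sum_insert (by simp; omega), Finset.sum_insert (by simp),
      Finset.sum_insert (by simp; omega), Finset.sum_singleton] at h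
    simpa [e] using h⟩

section Chain

variable {V : Type*} [MeasurableSpace V] [Countable V] [DiscreteMeasurableSpace V]

/-- The transition probabilities `step`, as a kernel that gives the position at time `n + 1` from
the positions up to time `n`; only the position at time `n` is used. -/
def chainKernel (step : V → PMF V) (n : ℕ) : Kernel (Π _ : Finset.Iic n, V) V :=
  (Kernel.ofFunOfCountable fun v => (step v).toMeasure).comap
    (fun h => h ⟨n, Finset.mem_Iic.2 le_rfl⟩) (measurable_pi_apply _)

instance chainKernel_isMarkovKernel (step : V → PMF V) (n : ℕ) :
    IsMarkovKernel (chainKernel step n) :=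
  ⟨fun h => PMF.toMeasure.isProbabilityMeasure (step (h ⟨n, Finset.mem_Iic.2 le_rfl⟩))⟩

/-- The law, on the space `ℕ → V` of trajectories, of the (time-homogeneous) Markov chain with
transition probabilities `step` that starts from `x`. -/
def chainLaw (step : V → PMF V) (x : V) : Measure (ℕ → V) :=
  Kernel.trajMeasure (X := fun _ => V) (Measure.dirac x) (chainKernel step)

instance chainLaw_isProbabilityMeasure (step : V → PMF V) (x : V) :
    IsProbabilityMeasure (chainLaw step x) := by
  unfold chainLaw; infer_instance

end Chain

/-- A point of `ℤ²` as a point of the Euclidean plane. -/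
def toPlane (x : ℤ × ℤ) : EuclideanSpace ℝ (Fin 2) := !₂[(x.1 : ℝ), (x.2 : ℝ)]

/-- A family of laws of walks (`P x` being the law of the walk from `x`) is diffusive if the mean
square displacement after `n` steps lies between `C₁ n` and `C₂ n`, with constants
`C₂ > C₁ > 0` that do not depend on the starting point. -/
def IsDiffusive (P : ℤ × ℤ → Measure (ℕ → ℤ × ℤ)) : Prop :=
  ∃ C₁ C₂ : ℝ, 0 < C₁ ∧ C₁ < C₂ ∧ ∀ (x : ℤ × ℤ) (n : ℕ),
    C₁ * n ≤ ∫ X, ‖toPlane (X n) - toPlane (X 0)‖ ^ 2 ∂(P x) ∧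
    ∫ X, ‖toPlane (X n) - toPlane (X 0)‖ ^ 2 ∂(P x) ≤ C₂ * n

/-- A Gaussian measure on the plane that is centered and has a positive definite covariance. -/
structure IsNondegenerateCenteredGaussian (γ : Measure (EuclideanSpace ℝ (Fin 2))) : Prop where
  isGaussian : IsGaussian γ
  centered : ∫ z, z ∂γ = 0
  nondegenerate : ∀ u : EuclideanSpace ℝ (Fin 2), u ≠ 0 → 0 < Var[fun z => inner ℝ u z; γ]

/-- The central limit theorem with zero asymptotic velocity: the walk is diffusive and, from every
starting point, `Xₙ / √n` tends in distribution to a nondegenerate centered Gaussian (the same one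
for all starting points). -/
def SatisfiesCLT (P : ℤ × ℤ → Measure (ℕ → ℤ × ℤ)) [∀ x, IsProbabilityMeasure (P x)] : Prop :=
  IsDiffusive P ∧
  ∃ (γ : Measure (EuclideanSpace ℝ (Fin 2))) (_ : IsProbabilityMeasure γ),
    IsNondegenerateCenteredGaussian γ ∧
    ∀ x : ℤ × ℤ, TendstoInDistribution
      (fun (n : ℕ) (X : ℕ → ℤ × ℤ) => (√(n : ℝ))⁻¹ • toPlane (X n)) atTop
      (fun z => z) (fun _ => P x) γ

/-- The walk is recurrent if, from every starting point `x`, it almost surely returns to `x` at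
some positive time. -/
def IsRecurrent (P : ℤ × ℤ → Measure (ℕ → ℤ × ℤ)) : Prop :=
  ∀ x : ℤ × ℤ, P x {X | ∃ n : ℕ, 0 < n ∧ X n = x ∧ X 0 = x} = 1

/-- The map `(x₁, x₂) ↦ (⌊x₁ / 2⌋, ⌊x₂ / 2⌋)`, which identifies the four points of each `2 × 2`
block (integer division by `2` rounds down, for negative integers too). -/
def block (x : ℤ × ℤ) : ℤ × ℤ := (x.1 / 2, x.2 / 2)

end

/-! Put h¹ = x¹ + ε(x²)/2 and h² = x² + ε(x¹)/2 (`harmonicFst`, `harmonicSnd`). The two edges out of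
x move h by opposite vectors ±(ε(x²), -ε(x¹)), and every step flips exactly one of ε(x¹), ε(x²),
hence the product ε(x¹)ε(x²). So h is a walk driven by independent fair signs whose steps alternate
deterministically between the two diagonals, and it stays at bounded distance from x.

This gives the CLT: squared increments equal 2, so E|h_n - h_0|² = 2n (`integral_harmonic_sq`), and
the characteristic function is an explicit product of cosines (`integral_exp_harmonic`), whose
scaling limit is that of the standard Gaussian.

For recurrence, the walk at even times is, up to one parity bit, a pair of independent simple walks
on ℤ (`manhattanProb_two_mul_succ`). The return probability after 4(m+1) steps is at least
1/(8(m+1)), so the expected number of visits is infinite, and a last-visit decomposition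
(`chainLaw_return_eq_one`) concludes.

For the blocks, two steps from any x with x¹ + x² even lead uniformly to the four neighbouring
blocks (`sum_block_neighbours`) and again to a point with even sum, so the induction can continue.

Independence is never invoked as such: the computations are inductions on time, for all starting
points at once, from the first-step decomposition `chainLaw_eq_sum_first_step`. -/

/-! ### Cylinders in trajectory space. -/

section Trajectories

variable {V : Type*}

/-- The trajectories that agree with `w` up to time `n`. -/
def pathCylinder (n : ℕ) (w : ℕ → V) : Set (ℕ → V) := {X | ∀ i ≤ n, X i = w i}

/-- The trajectory that starts from `x` and then follows `X`. -/
def consPath (x : V) (X : ℕ → V) : ℕ → V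
  | 0 => x
  | n + 1 => X n

@[simp] lemma consPath_zero (x : V) (X : ℕ → V) : consPath x X 0 = x := rfl

@[simp] lemma consPath_succ (x : V) (X : ℕ → V) (n : ℕ) : consPath x X (n + 1) = X n := rfl

lemma pathCylinder_succ (n : ℕ) (w : ℕ → V) :
    pathCylinder (n + 1) w = pathCylinder n w ∩ {X | X (n + 1) = w (n + 1)} := by
  ext X
  simp only [pathCylinder, Set.mem_ofPred_eq, Set.mem_inter_iff, Nat.le_succ_iff]
  grind

lemma consPath_mem_pathCylinder_succ {n : ℕ} {w : ℕ → V} {x : V} {X : ℕ → V} :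
    consPath x X ∈ pathCylinder (n + 1) w ↔
      x = w 0 ∧ X ∈ pathCylinder n fun i => w (i + 1) := by
  refine ⟨fun h => ⟨h 0 (Nat.zero_le _), fun i hi => h (i + 1) (by lia)⟩, fun h i hi => ?_⟩
  cases i with
  | zero => exact h.1
  | succ i => exact h.2 i (by lia)

lemma pathCylinder_eq_preimage (n : ℕ) (w : ℕ → V) :
    pathCylinder n w = Preorder.frestrictLe (π := fun _ : ℕ => V) n ⁻¹'
      {Preorder.frestrictLe (π := fun _ : ℕ => V) n w} := by
  ext X
  simp [pathCylinder, funext_iff]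

variable [MeasurableSpace V]

@[fun_prop]
lemma measurable_consPath (x : V) : Measurable (consPath x) :=
  measurable_pi_iff.2 fun n => by cases n <;> (simp only [consPath]; fun_prop)

variable [DiscreteMeasurableSpace V]

lemma measurableSet_eval_eq (n : ℕ) (v : V) : MeasurableSet {X : ℕ → V | X n = v} :=
  measurableSet_preimage (t := {v}) (measurable_pi_apply n) (measurableSet_singleton v)

lemma measurableSet_pathCylinder (n : ℕ) (w : ℕ → V) : MeasurableSet (pathCylinder n w) := by
  have : pathCylinder n w = ⋂ i ∈ Finset.Iic n, {X | X i = w i} := by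
    ext; simp [pathCylinder]
  rw [this]
  exact Finset.measurableSet_biInter _ fun i _ => measurableSet_eval_eq i _

/-- A probability measure on trajectories in a countable set is determined by the cylinders. -/
lemma ext_of_pathCylinder [Countable V] {μ ν : Measure (ℕ → V)} [IsProbabilityMeasure μ]
    [IsProbabilityMeasure ν] (h : ∀ n w, μ (pathCylinder n w) = ν (pathCylinder n w)) :
    μ = ν := by
  rcases isEmpty_or_nonempty V with hV | hV
  · exact Subsingleton.elim _ _
  have key : ∀ n, μ.map (Preorder.frestrictLe n) = ν.map (Preorder.frestrictLe n) := by
    intro n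
    refine Measure.ext_of_singleton fun a => ?_
    obtain ⟨w, rfl⟩ : ∃ w : ℕ → V, Preorder.frestrictLe (π := fun _ : ℕ => V) n w = a :=
      ⟨fun i => if hi : i ∈ Finset.Iic n then a ⟨i, hi⟩ else Classical.arbitrary V, by
        ext i; have := i.2; simp only [Preorder.frestrictLe_apply]; exact dif_pos this⟩
    rw [Measure.map_apply (by fun_prop) (measurableSet_singleton _),
      Measure.map_apply (by fun_prop) (measurableSet_singleton _), ← pathCylinder_eq_preimage, h]
  -- Every finite set of times lies in an initial segment, so all finite-dimensional marginals agree
  -- and uniqueness of projective limits applies.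
  have hproj : ∀ I : Finset ℕ, μ.map I.restrict = ν.map I.restrict := by
    intro I
    have hI := I.subset_Iic_sup_id
    have e : (I.restrict : (ℕ → V) → _) =
        Finset.restrict₂ (π := fun _ => V) hI ∘ Preorder.frestrictLe (I.sup id) := rfl
    rw [e, ← Measure.map_map (by fun_prop) (by fun_prop), key,
      Measure.map_map (by fun_prop) (by fun_prop)]
  have : ∀ I : Finset ℕ, IsFiniteMeasure (ν.map (I.restrict (π := fun _ : ℕ => V))) :=
    fun I => inferInstance
  exact IsProjectiveLimit.unique (P := fun I => ν.map I.restrict) hproj fun _ => rfl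

end Trajectories

/-! ### Markov chains: cylinder probabilities, first-step decomposition, Markov property. -/

section ChainLaw

variable {V : Type*} [MeasurableSpace V] [Countable V] [DiscreteMeasurableSpace V]
  (step : V → PMF V) (x : V)

lemma chainLaw_pathCylinder_zero (w : ℕ → V) [Decidable (w 0 = x)] :
    chainLaw step x (pathCylinder 0 w) = if w 0 = x then 1 else 0 := by
  have h : (chainLaw step x).map (Preorder.frestrictLe 0) =
      Measure.dirac (fun _ => x) := by
    rw [chainLaw, Kernel.trajMeasure, Measure.map_comp _ _ (by fun_prop),
      Kernel.traj_map_frestrictLe, Kernel.partialTraj_self, Measure.id_comp]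
    exact Measure.map_dirac' (MeasurableEquiv.measurable _) x
  rw [pathCylinder_eq_preimage, ← Measure.map_apply (by fun_prop) (measurableSet_singleton _), h,
    Measure.dirac_apply' _ (measurableSet_singleton _)]
  classical
  rw [Set.indicator_apply]
  refine if_congr ?_ rfl rfl
  simp only [Set.mem_singleton_iff, funext_iff]
  refine ⟨fun h => (h ⟨0, by simp⟩).symm, fun h i => ?_⟩
  obtain ⟨i, hi⟩ := i
  obtain rfl : i = 0 := by simpa using hi
  exact h.symm

/-- The trajectory measure disintegrates over the first `n` steps through `chainKernel`; on a
product of two singletons this leaves one transition factor. -/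
lemma chainLaw_pathCylinder_succ (n : ℕ) (w : ℕ → V) :
    chainLaw step x (pathCylinder (n + 1) w) =
      chainLaw step x (pathCylinder n w) * step (w n) (w (n + 1)) := by
  have h := Kernel.map_frestrictLe_trajMeasure_compProd_eq_map_trajMeasure
    (X := fun _ => V) (μ₀ := Measure.dirac x) (κ := chainKernel step) (a := n)
  have h2 := congrArg (fun m => m ({Preorder.frestrictLe (π := fun _ : ℕ => V) n w} ×ˢ
    {w (n + 1)})) h
  beta_reduce at h2
  rw [Measure.compProd_apply_prod (measurableSet_singleton _) (measurableSet_singleton _),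
    Measure.map_apply (by fun_prop)
      ((measurableSet_singleton _).prod (measurableSet_singleton _)),
    lintegral_singleton,
    Measure.map_apply (by fun_prop) (measurableSet_singleton _), ← pathCylinder_eq_preimage] at h2
  have e : (fun X : ℕ → V => (Preorder.frestrictLe (π := fun _ : ℕ => V) n X, X (n + 1))) ⁻¹'
      ({Preorder.frestrictLe (π := fun _ : ℕ => V) n w} ×ˢ {w (n + 1)}) =
      pathCylinder (n + 1) w := by
    rw [pathCylinder_succ, pathCylinder_eq_preimage]
    rfl
  rw [e] at h2
  change _ = chainLaw step x (pathCylinder (n + 1) w) at h2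
  rw [← h2, mul_comm]
  congr 1
  change (step (w n)).toMeasure {w (n + 1)} = _
  exact (PMF.toMeasure_apply_singleton _ _ (measurableSet_singleton _))

lemma chainLaw_pathCylinder (n : ℕ) (w : ℕ → V) [Decidable (w 0 = x)] :
    chainLaw step x (pathCylinder n w) =
      (if w 0 = x then 1 else 0) * ∏ i ∈ Finset.range n, step (w i) (w (i + 1)) := by
  induction n with
  | zero => simp [chainLaw_pathCylinder_zero]
  | succ n ih => rw [chainLaw_pathCylinder_succ, ih, Finset.prod_range_succ, mul_assoc]

/-- The decomposition of the law of a Markov chain according to its first step. -/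
lemma chainLaw_eq_sum_first_step :
    chainLaw step x =
      Measure.sum fun y => step x y • (chainLaw step y).map (consPath x) := by
  have hmap : ∀ y, IsProbabilityMeasure ((chainLaw step y).map (consPath x)) :=
    fun y => Measure.isProbabilityMeasure_map (by fun_prop)
  have : IsProbabilityMeasure
      (Measure.sum fun y => step x y • (chainLaw step y).map (consPath x)) := by
    constructor
    simp [Measure.sum_apply _ MeasurableSet.univ, PMF.tsum_coe]
  refine ext_of_pathCylinder fun n w => ?_
  classical
  rw [Measure.sum_apply _ (measurableSet_pathCylinder n w), chainLaw_pathCylinder]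
  simp only [Measure.smul_apply, smul_eq_mul,
    Measure.map_apply (measurable_consPath x) (measurableSet_pathCylinder n w)]
  cases n with
  | zero =>
    have : consPath x ⁻¹' pathCylinder 0 w = if w 0 = x then Set.univ else ∅ := by
      ext X; split_ifs with h <;> simp [pathCylinder, h, eq_comm]
    rw [this]
    split_ifs <;> simp [PMF.tsum_coe]
  | succ n =>
    have : consPath x ⁻¹' pathCylinder (n + 1) w =
        if w 0 = x then pathCylinder n (fun i => w (i + 1)) else ∅ := by
      ext X
      rw [Set.mem_preimage, consPath_mem_pathCylinder_succ]
      split_ifs with h <;> (simp [h]; try tauto)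
    -- The first transition factor is split off; in the sum over first steps only `y = w 1`
    -- survives.
    rw [this, Finset.prod_range_succ']
    split_ifs with h
    · simp only [chainLaw_pathCylinder, ← mul_assoc, mul_ite, mul_zero, ite_mul, zero_mul,
        zero_add, one_mul]
      rw [tsum_eq_single (w 1) (fun y hy => if_neg (fun e => hy e.symm)), if_pos rfl, h, mul_comm]
    · simp

lemma chainLaw_apply {A : Set (ℕ → V)} (hA : MeasurableSet A) :
    chainLaw step x A = ∑' y, step x y * chainLaw step y (consPath x ⁻¹' A) := by
  conv_lhs => rw [chainLaw_eq_sum_first_step]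
  simp [Measure.sum_apply _ hA, Measure.map_apply (measurable_consPath x) hA]

lemma ae_eval_zero : ∀ᵐ X ∂chainLaw step x, X 0 = x := by
  classical
  have h := chainLaw_pathCylinder_zero step x (fun _ => x)
  rw [if_pos rfl] at h
  have h2 : {X : ℕ → V | X 0 = x} = pathCylinder 0 (fun _ => x) := by
    ext; simp [pathCylinder]
  rw [← mem_ae_iff_prob_eq_one (measurableSet_pathCylinder 0 _)] at h
  rw [← h2] at h
  exact h

/-- The Markov property at a fixed time. -/
lemma chainLaw_markov {A : Set (ℕ → V)} (hA : MeasurableSet A) (n : ℕ) (y : V) :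
    chainLaw step x {X | X n = y ∧ (fun k => X (n + k)) ∈ A} =
      chainLaw step x {X | X n = y} * chainLaw step y A := by
  have hm : ∀ n, MeasurableSet {X : ℕ → V | X n = y ∧ (fun k => X (n + k)) ∈ A} := fun n =>
    (measurableSet_eval_eq n y).inter (measurable_pi_iff.2 (fun k => measurable_pi_apply _) hA)
  induction n generalizing x with
  | zero =>
    simp only [zero_add]
    by_cases h : x = y
    · subst h
      have h1 : chainLaw step x {X | X 0 = x} = 1 :=
        (mem_ae_iff_prob_eq_one (measurableSet_eval_eq 0 x)).1 (ae_eval_zero step x)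
      rw [h1, one_mul]
      refine measure_congr ?_
      filter_upwards [ae_eval_zero step x] with X hX
      exact propext (and_iff_right hX)
    · have h1 : chainLaw step x {X | X 0 = y} = 0 := by
        refine measure_eq_zero_iff_ae_notMem.2 ?_
        filter_upwards [ae_eval_zero step x] with X hX hX'
        exact h (hX.symm.trans hX')
      rw [h1, zero_mul]
      exact measure_mono_null (fun X hX => hX.1) h1
  | succ n ih =>
    -- Both sides are conditioned on the first step, after which `n` steps remain.
    rw [chainLaw_apply step x (hm _), chainLaw_apply step x (measurableSet_eval_eq _ y),
      ← ENNReal.tsum_mul_right]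
    refine tsum_congr fun z => ?_
    rw [mul_assoc, Set.preimage_ofPred_eq, Set.preimage_ofPred_eq]
    simp only [consPath_succ, ← ih z]
    simp only [add_right_comm n 1, consPath_succ]

end ChainLaw

/-! ### Arithmetic of the direction sign. -/

section DirSign

lemma dirSign_of_even {j : ℤ} (h : Even j) : dirSign j = 1 := if_pos h

lemma dirSign_of_odd {j : ℤ} (h : Odd j) : dirSign j = -1 := if_neg (Int.not_even_iff_odd.2 h)

lemma dirSign_eq_one_or (j : ℤ) : dirSign j = 1 ∨ dirSign j = -1 := by
  unfold dirSign; split_ifs <;> simp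

lemma dirSign_eq_emod (j : ℤ) : dirSign j = 1 - 2 * (j % 2) := by
  rcases Int.even_or_odd j with h | h
  · rw [dirSign_of_even h, Int.even_iff.1 h]; rfl
  · rw [dirSign_of_odd h, Int.odd_iff.1 h]; rfl

@[simp] lemma dirSign_neg (j : ℤ) : dirSign (-j) = dirSign j := by
  simp only [dirSign, even_neg]

@[simp] lemma dirSign_add_one (j : ℤ) : dirSign (j + 1) = -dirSign j := by
  simp only [dirSign_eq_emod]; lia

@[simp] lemma dirSign_add_dirSign (i j : ℤ) : dirSign (i + dirSign j) = -dirSign i := by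
  simp only [dirSign_eq_emod]; lia

end DirSign

/-! ### First-step analysis of the Manhattan walk. -/

section ManhattanChain

/-- The end point of the horizontal edge of the Manhattan lattice that goes out of `x`. -/
def moveHorizontal (x : ℤ × ℤ) : ℤ × ℤ := (x.1 + dirSign x.2, x.2)

/-- The end point of the vertical edge of the Manhattan lattice that goes out of `x`. -/
def moveVertical (x : ℤ × ℤ) : ℤ × ℤ := (x.1, x.2 + dirSign x.1)

lemma moveHorizontal_ne_moveVertical (x : ℤ × ℤ) : moveHorizontal x ≠ moveVertical x := by
  intro h
  exact dirSign_ne_zero x.2 (by simpa [moveHorizontal, moveVertical] using congrArg Prod.fst h)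

lemma manhattanStep_apply (x y : ℤ × ℤ) [Decidable (y = moveHorizontal x ∨ y = moveVertical x)] :
    manhattanStep x y = if y = moveHorizontal x ∨ y = moveVertical x then 2⁻¹ else 0 := by
  classical
  rw [← one_div]
  exact if_congr Iff.rfl rfl rfl

lemma tsum_manhattanStep_mul (x : ℤ × ℤ) (f : ℤ × ℤ → ℝ≥0∞) :
    ∑' y, manhattanStep x y * f y =
      2⁻¹ * f (moveHorizontal x) + 2⁻¹ * f (moveVertical x) := by
  rw [tsum_eq_sum (s := {moveHorizontal x, moveVertical x}),
    Finset.sum_pair (moveHorizontal_ne_moveVertical x)]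
  · simp [manhattanStep_apply]
  · intro y hy
    rw [manhattanStep_apply, if_neg (by simpa using hy), zero_mul]

lemma manhattan_apply (x : ℤ × ℤ) {A : Set (ℕ → ℤ × ℤ)} (hA : MeasurableSet A) :
    chainLaw manhattanStep x A =
      2⁻¹ * chainLaw manhattanStep (moveHorizontal x) (consPath x ⁻¹' A) +
      2⁻¹ * chainLaw manhattanStep (moveVertical x) (consPath x ⁻¹' A) := by
  rw [chainLaw_apply _ _ hA, tsum_manhattanStep_mul]

lemma manhattan_eq_add (x : ℤ × ℤ) :
    chainLaw manhattanStep x =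
      (2⁻¹ : ℝ≥0∞) • (chainLaw manhattanStep (moveHorizontal x)).map (consPath x) +
      (2⁻¹ : ℝ≥0∞) • (chainLaw manhattanStep (moveVertical x)).map (consPath x) := by
  ext A hA
  simp [manhattan_apply x hA, Measure.map_apply (measurable_consPath x) hA]

variable {E : Type*} [NormedAddCommGroup E]

lemma stronglyMeasurable_comp_eval (f : ℤ × ℤ → E) (n : ℕ) :
    StronglyMeasurable fun X : ℕ → ℤ × ℤ => f (X n) :=
  (StronglyMeasurable.of_discrete (f := f)).comp_measurable (measurable_pi_apply n)

/-- No growth condition on `f` is needed, since only finitely many positions can be reached in `n`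
steps. -/
lemma integrable_comp_eval (f : ℤ × ℤ → E) (n : ℕ) (x : ℤ × ℤ) :
    Integrable (fun X => f (X n)) (chainLaw manhattanStep x) := by
  induction n generalizing x with
  | zero =>
    refine (integrable_const (f x)).congr ?_
    filter_upwards [ae_eval_zero manhattanStep x] with X hX
    rw [hX]
  | succ n ih =>
    rw [manhattan_eq_add]
    refine Integrable.add_measure ?_ ?_ <;>
    · refine Integrable.smul_measure ?_ (by simp)
      rw [integrable_map_measure (stronglyMeasurable_comp_eval f _).aestronglyMeasurable
        (by fun_prop)]
      exact ih _

variable [NormedSpace ℝ E]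

lemma integral_comp_eval_zero [CompleteSpace E] (f : ℤ × ℤ → E) (x : ℤ × ℤ) :
    ∫ X, f (X 0) ∂chainLaw manhattanStep x = f x := by
  have : (fun X : ℕ → ℤ × ℤ => f (X 0)) =ᵐ[chainLaw manhattanStep x] fun _ => f x := by
    filter_upwards [ae_eval_zero manhattanStep x] with X hX
    rw [hX]
  rw [integral_congr_ae this]
  simp

lemma integral_comp_eval_succ (f : ℤ × ℤ → E) (n : ℕ) (x : ℤ × ℤ) :
    ∫ X, f (X (n + 1)) ∂chainLaw manhattanStep x =
      (2⁻¹ : ℝ) • ∫ X, f (X n) ∂chainLaw manhattanStep (moveHorizontal x) +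
      (2⁻¹ : ℝ) • ∫ X, f (X n) ∂chainLaw manhattanStep (moveVertical x) := by
  have hi : ∀ y, Integrable (fun X : ℕ → ℤ × ℤ => f (X (n + 1)))
      ((2⁻¹ : ℝ≥0∞) • (chainLaw manhattanStep y).map (consPath x)) := by
    intro y
    refine Integrable.smul_measure ?_ (by simp)
    rw [integrable_map_measure (stronglyMeasurable_comp_eval f _).aestronglyMeasurable
      (by fun_prop)]
    exact integrable_comp_eval f n y
  rw [manhattan_eq_add, integral_add_measure (hi _) (hi _), integral_smul_measure,
    integral_smul_measure, integral_map (by fun_prop)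
      (stronglyMeasurable_comp_eval f _).aestronglyMeasurable,
    integral_map (by fun_prop) (stronglyMeasurable_comp_eval f _).aestronglyMeasurable]
  simp

end ManhattanChain

/-! ### Martingale coordinates and the diffusive bounds. -/

section SecondMoment

/-- The first coordinate of the walk, corrected so that it is a martingale. -/
noncomputable def harmonicFst (x : ℤ × ℤ) : ℝ := x.1 + dirSign x.2 / 2

/-- The second coordinate of the walk, corrected so that it is a martingale. -/
noncomputable def harmonicSnd (x : ℤ × ℤ) : ℝ := x.2 + dirSign x.1 / 2

lemma harmonicFst_moveHorizontal (x : ℤ × ℤ) :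
    harmonicFst (moveHorizontal x) = harmonicFst x + dirSign x.2 := by
  simp only [harmonicFst, moveHorizontal]; push_cast; ring

lemma harmonicSnd_moveHorizontal (x : ℤ × ℤ) :
    harmonicSnd (moveHorizontal x) = harmonicSnd x - dirSign x.1 := by
  simp only [harmonicSnd, moveHorizontal, dirSign_add_dirSign]; push_cast; ring

/-- A vertical step flips `dirSign x.2`, so the correction term alone moves, by exactly the opposite
of the horizontal increment. -/
lemma harmonicFst_moveVertical (x : ℤ × ℤ) :
    harmonicFst (moveVertical x) = harmonicFst x - dirSign x.2 := by
  simp only [harmonicFst, moveVertical, dirSign_add_dirSign]; push_cast; ring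

lemma harmonicSnd_moveVertical (x : ℤ × ℤ) :
    harmonicSnd (moveVertical x) = harmonicSnd x + dirSign x.1 := by
  simp only [harmonicSnd, moveVertical]; push_cast; ring

lemma dirSign_cast_sq (j : ℤ) : (dirSign j : ℝ) ^ 2 = 1 := by
  rcases dirSign_eq_one_or j with h | h <;> simp [h]

lemma integral_harmonic_sq (a b : ℝ) (n : ℕ) (x : ℤ × ℤ) :
    ∫ X, ((harmonicFst (X n) - a) ^ 2 + (harmonicSnd (X n) - b) ^ 2)
        ∂chainLaw manhattanStep x =
      (harmonicFst x - a) ^ 2 + (harmonicSnd x - b) ^ 2 + 2 * n := by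
  induction n generalizing x with
  | zero =>
    rw [integral_comp_eval_zero fun y => (harmonicFst y - a) ^ 2 + (harmonicSnd y - b) ^ 2]
    simp
  | succ n ih =>
    rw [integral_comp_eval_succ fun y => (harmonicFst y - a) ^ 2 + (harmonicSnd y - b) ^ 2,
      ih, ih, harmonicFst_moveHorizontal, harmonicSnd_moveHorizontal, harmonicFst_moveVertical,
      harmonicSnd_moveVertical, smul_eq_mul, smul_eq_mul]
    push_cast
    linear_combination dirSign_cast_sq x.1 + dirSign_cast_sq x.2

lemma norm_toPlane_sub_sq (x y : ℤ × ℤ) :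
    ‖toPlane x - toPlane y‖ ^ 2 = ((x.1 : ℝ) - y.1) ^ 2 + ((x.2 : ℝ) - y.2) ^ 2 := by
  simp [EuclideanSpace.norm_sq_eq, toPlane]

/-- With d = (a - b)/2, so that d² ≤ 1, these are weighted forms of (u + v)² ≤ 2u² + 2v². The factor
3 in the second bound makes the lower diffusive bound nontrivial already at `n = 2`; a factor 2
would only give n - 2. -/
lemma sq_bounds_of_sq_eq_one {u a b : ℝ} (ha : a ^ 2 = 1) (hb : b ^ 2 = 1) :
    u ^ 2 ≤ 2 * (u + (a - b) / 2) ^ 2 + 2 ∧ (u + (a - b) / 2) ^ 2 ≤ 3 * u ^ 2 + 3 / 2 := by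
  have h : ((a - b) / 2) ^ 2 ≤ 1 := by nlinarith [sq_nonneg (a + b)]
  generalize (a - b) / 2 = d at h
  constructor
  · nlinarith [sq_nonneg (u + 2 * d)]
  · nlinarith [sq_nonneg (u - d / 2)]

lemma displacement_sq_bounds (x y : ℤ × ℤ) :
    ‖toPlane y - toPlane x‖ ^ 2 ≤ 2 * ((harmonicFst y - harmonicFst x) ^ 2 +
        (harmonicSnd y - harmonicSnd x) ^ 2) + 4 ∧
      (harmonicFst y - harmonicFst x) ^ 2 + (harmonicSnd y - harmonicSnd x) ^ 2 ≤
        3 * ‖toPlane y - toPlane x‖ ^ 2 + 3 := by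
  have h1 := sq_bounds_of_sq_eq_one (u := (y.1 : ℝ) - x.1) (dirSign_cast_sq y.2)
    (dirSign_cast_sq x.2)
  have h2 := sq_bounds_of_sq_eq_one (u := (y.2 : ℝ) - x.2) (dirSign_cast_sq y.1)
    (dirSign_cast_sq x.1)
  have e1 : harmonicFst y - harmonicFst x =
      (y.1 : ℝ) - x.1 + ((dirSign y.2 : ℝ) - dirSign x.2) / 2 := by
    simp only [harmonicFst]; ring
  have e2 : harmonicSnd y - harmonicSnd x =
      (y.2 : ℝ) - x.2 + ((dirSign y.1 : ℝ) - dirSign x.1) / 2 := by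
    simp only [harmonicSnd]; ring
  rw [norm_toPlane_sub_sq, e1, e2]
  constructor <;> linarith [h1.1, h1.2, h2.1, h2.2]

lemma isDiffusive_manhattan : IsDiffusive (chainLaw manhattanStep) := by
  -- The comparison gives (2n - 3)/3 ≤ E|X_n - x|² ≤ 4n + 4. For n ≥ 2 these imply n/6 and 8n (the
  -- former with equality at n = 2); n = 0, 1 are computed directly.
  refine ⟨1 / 6, 8, by norm_num, by norm_num, fun x n => ?_⟩
  have hstart : ∫ X, ‖toPlane (X n) - toPlane (X 0)‖ ^ 2 ∂chainLaw manhattanStep x =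
      ∫ X, ‖toPlane (X n) - toPlane x‖ ^ 2 ∂chainLaw manhattanStep x := by
    refine integral_congr_ae ?_
    filter_upwards [ae_eval_zero manhattanStep x] with X hX
    rw [hX]
  rw [hstart]
  have hd := integrable_comp_eval (fun y => ‖toPlane y - toPlane x‖ ^ 2) n x
  have hh := integrable_comp_eval (fun y => (harmonicFst y - harmonicFst x) ^ 2 +
    (harmonicSnd y - harmonicSnd x) ^ 2) n x
  have hval := integral_harmonic_sq (harmonicFst x) (harmonicSnd x) n x
  simp only [sub_self, ne_eq, OfNat.ofNat_ne_zero, not_false_eq_true, zero_pow, zero_add] at hval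
  have hupper := integral_mono hd ((hh.const_mul 2).add (integrable_const 4))
    fun X => (displacement_sq_bounds x (X n)).1
  have hlower := integral_mono hh ((hd.const_mul 3).add (integrable_const 3))
    fun X => (displacement_sq_bounds x (X n)).2
  simp only [Pi.add_apply] at hupper hlower
  rw [integral_add (hh.const_mul 2) (integrable_const 4), integral_const_mul, hval,
    integral_const, probReal_univ, one_smul] at hupper
  rw [integral_add (hd.const_mul 3) (integrable_const 3), integral_const_mul, hval,
    integral_const, probReal_univ, one_smul] at hlower
  rcases Nat.lt_or_ge n 2 with hn | hn
  · have h0 := integral_comp_eval_zero (fun y => ‖toPlane y - toPlane x‖ ^ 2)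
    interval_cases n
    · rw [h0]; simp
    · rw [integral_comp_eval_succ (fun y => ‖toPlane y - toPlane x‖ ^ 2) 0, h0, h0,
        norm_toPlane_sub_sq, norm_toPlane_sub_sq]
      simp only [moveHorizontal, moveVertical]
      push_cast
      simp only [add_sub_cancel_left, sub_self, dirSign_cast_sq]
      norm_num
  · have hn' : (2 : ℝ) ≤ n := by exact_mod_cast hn
    constructor <;> linarith

end SecondMoment

/-! ### Characteristic functions and the Gaussian limit. -/

section CharacteristicFunction

open Complex in
-- Averaging over a fair sign produces one cosine per step, and the alternation of the sign `dirSign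
-- x.1 * dirSign x.2` makes the two cosines take turns.
lemma integral_exp_harmonic (s t : ℝ) (n : ℕ) (x : ℤ × ℤ) :
    ∫ X, cexp (((s * harmonicFst (X n) + t * harmonicSnd (X n) : ℝ) : ℂ) * I)
        ∂chainLaw manhattanStep x =
      cexp (((s * harmonicFst x + t * harmonicSnd x : ℝ) : ℂ) * I) *
        ((Real.cos (s - dirSign x.1 * dirSign x.2 * t) ^ ((n + 1) / 2) *
          Real.cos (s + dirSign x.1 * dirSign x.2 * t) ^ (n / 2) : ℝ) : ℂ) := by
  have step (A B : ℝ) (C : ℂ) :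
      (2⁻¹ : ℝ) • (cexp (((A + B : ℝ) : ℂ) * I) * C) +
        (2⁻¹ : ℝ) • (cexp (((A - B : ℝ) : ℂ) * I) * C) =
      cexp ((A : ℂ) * I) * ((Real.cos B : ℝ) * C) := by
    push_cast
    rw [add_mul, sub_mul, exp_add, exp_sub, Complex.cos, real_smul, real_smul,
      div_eq_mul_inv (cexp _), ← exp_neg]
    push_cast [neg_mul]
    ring
  induction n generalizing x with
  | zero =>
    rw [integral_comp_eval_zero
      fun y => cexp (((s * harmonicFst y + t * harmonicSnd y : ℝ) : ℂ) * I)]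
    simp
  | succ n ih =>
    have hB : Real.cos (s * dirSign x.2 - t * dirSign x.1) =
        Real.cos (s - dirSign x.1 * dirSign x.2 * t) := by
      rcases dirSign_eq_one_or x.1 with h1 | h1 <;> rcases dirSign_eq_one_or x.2 with h2 | h2 <;>
        rw [h1, h2] <;> push_cast
      · congr 1; ring
      · rw [← Real.cos_neg]; congr 1; ring
      · congr 1; ring
      · rw [← Real.cos_neg]; congr 1; ring
    have e1 : s * harmonicFst (moveHorizontal x) + t * harmonicSnd (moveHorizontal x) =
        s * harmonicFst x + t * harmonicSnd x + (s * dirSign x.2 - t * dirSign x.1) := by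
      rw [harmonicFst_moveHorizontal, harmonicSnd_moveHorizontal]; ring
    have e2 : s * harmonicFst (moveVertical x) + t * harmonicSnd (moveVertical x) =
        s * harmonicFst x + t * harmonicSnd x - (s * dirSign x.2 - t * dirSign x.1) := by
      rw [harmonicFst_moveVertical, harmonicSnd_moveVertical]; ring
    rw [integral_comp_eval_succ
      fun y => cexp (((s * harmonicFst y + t * harmonicSnd y : ℝ) : ℂ) * I), ih, ih, e1, e2]
    -- Either move reverses the product of the signs, so the two cosines exchange their exponents in
    -- the induction hypothesis.
    have d1 : ((dirSign (moveHorizontal x).1 : ℝ) * dirSign (moveHorizontal x).2) =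
        -(dirSign x.1 * dirSign x.2) := by
      simp [moveHorizontal]
    have d2 : ((dirSign (moveVertical x).1 : ℝ) * dirSign (moveVertical x).2) =
        -(dirSign x.1 * dirSign x.2) := by
      simp [moveVertical]
    rw [d1, d2, step, hB, ← ofReal_mul]
    congr 2
    have hn : (n + 1 + 1) / 2 = n / 2 + 1 := by lia
    rw [hn, pow_succ, neg_mul, sub_neg_eq_add, ← sub_eq_add_neg]
    ring

lemma tendsto_mul_cos_sub_one (a : ℝ) :
    Tendsto (fun n : ℕ => (n : ℝ) * (Real.cos ((√(n : ℝ))⁻¹ * a) - 1)) atTop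
      (𝓝 (-(a ^ 2 / 2))) := by
  have hsq : Tendsto (fun n : ℕ => (√(n : ℝ))⁻¹) atTop (𝓝 0) :=
    tendsto_inv_atTop_zero.comp (Real.tendsto_sqrt_atTop.comp tendsto_natCast_atTop_atTop)
  have hsmall : ∀ᶠ n : ℕ in atTop, |(√(n : ℝ))⁻¹ * a| ≤ 1 := by
    have h : Tendsto (fun n : ℕ => |(√(n : ℝ))⁻¹ * a|) atTop (𝓝 0) := by
      simpa using (hsq.mul_const a).abs
    exact h.eventually_le_const (by norm_num)
  rw [← tendsto_sub_nhds_zero_iff]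
  refine squeeze_zero_norm' (a := fun n : ℕ => a ^ 4 * (5 / 96) * (n : ℝ)⁻¹) ?_ ?_
  · filter_upwards [hsmall, eventually_gt_atTop 0] with n hn hpos
    have hn0 : (0 : ℝ) < n := by exact_mod_cast hpos
    have hb := Real.cos_bound hn
    have h2 : ((√(n : ℝ))⁻¹ * a) ^ 2 = (n : ℝ)⁻¹ * a ^ 2 := by
      rw [mul_pow, inv_pow, Real.sq_sqrt hn0.le]
    have h4 : |(√(n : ℝ))⁻¹ * a| ^ 4 = (n : ℝ)⁻¹ ^ 2 * a ^ 4 := by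
      rw [show 4 = 2 * 2 by norm_num, pow_mul, sq_abs, h2]; ring
    rw [h4, h2] at hb
    have e : (n : ℝ) * (Real.cos ((√(n : ℝ))⁻¹ * a) - 1) - -(a ^ 2 / 2) =
        n * (Real.cos ((√(n : ℝ))⁻¹ * a) - (1 - (n : ℝ)⁻¹ * a ^ 2 / 2)) := by
      field_simp; ring
    rw [e, norm_mul, Real.norm_eq_abs, Real.norm_eq_abs, abs_of_pos hn0]
    calc _ ≤ (n : ℝ) * ((n : ℝ)⁻¹ ^ 2 * a ^ 4 * (5 / 96)) := by gcongr
      _ = _ := by field_simp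
  · have h := (tendsto_inv_atTop_zero.comp tendsto_natCast_atTop_atTop).const_mul
      (a ^ 4 * (5 / 96))
    rw [mul_zero] at h
    exact h

/-- The power is exp((k n / n) · n log cos(a/√n)), and n log cos(a/√n) → -a²/2 by the preceding
expansion. -/
lemma tendsto_cos_pow {k : ℕ → ℕ} (hk : Tendsto (fun n => (k n : ℝ) / n) atTop (𝓝 2⁻¹)) (a : ℝ) :
    Tendsto (fun n : ℕ => Real.cos ((√(n : ℝ))⁻¹ * a) ^ k n) atTop
      (𝓝 (Real.exp (-(a ^ 2 / 4)))) := by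
  have hlog := Real.tendsto_nat_mul_log_one_add_of_tendsto (tendsto_mul_cos_sub_one a)
  have hprod := (Real.continuous_exp.tendsto _).comp (hk.mul hlog)
  have e : (2⁻¹ * -(a ^ 2 / 2) : ℝ) = -(a ^ 2 / 4) := by ring
  rw [e] at hprod
  refine hprod.congr' ?_
  have hcos : Tendsto (fun n : ℕ => Real.cos ((√(n : ℝ))⁻¹ * a)) atTop (𝓝 1) := by
    have hsq : Tendsto (fun n : ℕ => (√(n : ℝ))⁻¹ * a) atTop (𝓝 (0 * a)) :=
      (tendsto_inv_atTop_zero.comp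
        (Real.tendsto_sqrt_atTop.comp tendsto_natCast_atTop_atTop)).mul_const a
    have h := (Real.continuous_cos.tendsto _).comp hsq
    rw [zero_mul, Real.cos_zero] at h
    exact h
  filter_upwards [hcos.eventually_const_lt zero_lt_one, eventually_gt_atTop 0] with n hpos hn
  have hn0 : (n : ℝ) ≠ 0 := by exact_mod_cast hn.ne'
  simp only [Function.comp_apply, add_sub_cancel]
  rw [← mul_assoc, div_mul_cancel₀ _ hn0, Real.exp_nat_mul, Real.exp_log hpos]

lemma tendsto_half_div : Tendsto (fun n : ℕ => ((n / 2 : ℕ) : ℝ) / n) atTop (𝓝 2⁻¹) := by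
  have h := (tendsto_nat_floor_mul_div_atTop (R := ℝ) (a := 2⁻¹) (by norm_num)).comp
    tendsto_natCast_atTop_atTop
  refine h.congr fun n => ?_
  simp only [Function.comp_apply]
  rw [← Nat.floor_div_eq_div (K := ℝ), ← div_eq_inv_mul, Nat.cast_ofNat]

lemma tendsto_half_succ_div :
    Tendsto (fun n : ℕ => (((n + 1) / 2 : ℕ) : ℝ) / n) atTop (𝓝 2⁻¹) := by
  have h := tendsto_half_div.const_sub 1
  rw [show (1 - 2⁻¹ : ℝ) = 2⁻¹ by norm_num] at h
  refine h.congr' ?_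
  filter_upwards [eventually_gt_atTop 0] with n hn
  have hn0 : (n : ℝ) ≠ 0 := by exact_mod_cast hn.ne'
  have e : (((n + 1) / 2 : ℕ) : ℝ) + ((n / 2 : ℕ) : ℝ) = n := by
    rw [← Nat.cast_add]; congr 1; lia
  rw [one_sub_div hn0, ← e]
  ring

open Complex in
lemma tendsto_integral_exp_harmonic (s t : ℝ) (x : ℤ × ℤ) :
    Tendsto (fun n : ℕ => ∫ X, cexp ((((√(n : ℝ))⁻¹ * s * harmonicFst (X n) +
      (√(n : ℝ))⁻¹ * t * harmonicSnd (X n) : ℝ) : ℂ) * I) ∂chainLaw manhattanStep x) atTop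
      (𝓝 ((Real.exp (-((s ^ 2 + t ^ 2) / 2)) : ℝ) : ℂ)) := by
  simp_rw [integral_exp_harmonic]
  have hsq : Tendsto (fun n : ℕ => (√(n : ℝ))⁻¹) atTop (𝓝 0) :=
    tendsto_inv_atTop_zero.comp (Real.tendsto_sqrt_atTop.comp tendsto_natCast_atTop_atTop)
  have h1 : Tendsto (fun n : ℕ => cexp ((((√(n : ℝ))⁻¹ * s * harmonicFst x +
      (√(n : ℝ))⁻¹ * t * harmonicSnd x : ℝ) : ℂ) * I)) atTop (𝓝 1) := by
    have h : Tendsto (fun n : ℕ => ((√(n : ℝ))⁻¹ * s * harmonicFst x +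
      (√(n : ℝ))⁻¹ * t * harmonicSnd x : ℝ)) atTop (𝓝 0) := by
      simpa using ((hsq.mul_const s).mul_const (harmonicFst x)).add
        ((hsq.mul_const t).mul_const (harmonicSnd x))
    have hc : Continuous fun r : ℝ => cexp ((r : ℂ) * I) := by fun_prop
    have h' := (hc.tendsto 0).comp h
    rw [ofReal_zero, zero_mul, Complex.exp_zero] at h'
    exact h'
  have h2 := (tendsto_cos_pow tendsto_half_succ_div (s - dirSign x.1 * dirSign x.2 * t)).mul
    (tendsto_cos_pow tendsto_half_div (s + dirSign x.1 * dirSign x.2 * t))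
  have hval : -((s - dirSign x.1 * dirSign x.2 * t) ^ 2 / 4) +
      -((s + dirSign x.1 * dirSign x.2 * t) ^ 2 / 4) = -((s ^ 2 + t ^ 2) / 2) := by
    have h : ((dirSign x.1 : ℝ) * dirSign x.2) ^ 2 = 1 := by
      rw [mul_pow, dirSign_cast_sq, dirSign_cast_sq, one_mul]
    linear_combination (-t ^ 2 / 2) * h
  rw [← Real.exp_add, hval] at h2
  have h3 := h1.mul ((continuous_ofReal.tendsto _).comp h2)
  rw [one_mul] at h3
  refine h3.congr fun n => ?_
  simp only [Function.comp_apply]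
  congr 4
  · congr 1; ring
  · congr 1; ring

open Complex in
lemma norm_exp_sub_exp_harmonic_le (s t : ℝ) (x : ℤ × ℤ) :
    ‖cexp (((s * x.1 + t * x.2 : ℝ) : ℂ) * I) -
      cexp (((s * harmonicFst x + t * harmonicSnd x : ℝ) : ℂ) * I)‖ ≤ |s| + |t| := by
  have e : cexp (((s * harmonicFst x + t * harmonicSnd x : ℝ) : ℂ) * I) =
      cexp (((s * x.1 + t * x.2 : ℝ) : ℂ) * I) *
        cexp (I * ((s * (dirSign x.2 / 2) + t * (dirSign x.1 / 2) : ℝ) : ℂ)) := by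
    rw [← exp_add]
    congr 1
    simp only [harmonicFst, harmonicSnd]
    push_cast
    ring
  rw [e, norm_sub_rev, ← mul_sub_one, norm_mul, norm_exp_ofReal_mul_I, one_mul]
  refine Real.norm_exp_I_mul_ofReal_sub_one_le.trans ?_
  rw [Real.norm_eq_abs]
  have h : ∀ j, |(dirSign j / 2 : ℝ)| ≤ 1 := by
    intro j
    rcases dirSign_eq_one_or j with h | h <;> rw [h] <;> norm_num [abs_div]
  refine (abs_add_le _ _).trans ?_
  rw [abs_mul, abs_mul]
  exact add_le_add (mul_le_of_le_one_right (abs_nonneg s) (h _))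
    (mul_le_of_le_one_right (abs_nonneg t) (h _))

open Complex in
-- The bounded correction between h and x is divided by √n, so it vanishes in the limit.
lemma tendsto_integral_exp_coord (s t : ℝ) (x : ℤ × ℤ) :
    Tendsto (fun n : ℕ => ∫ X, cexp ((((√(n : ℝ))⁻¹ * s * (X n).1 +
      (√(n : ℝ))⁻¹ * t * (X n).2 : ℝ) : ℂ) * I) ∂chainLaw manhattanStep x) atTop
      (𝓝 ((Real.exp (-((s ^ 2 + t ^ 2) / 2)) : ℝ) : ℂ)) := by
  refine (tendsto_integral_exp_harmonic s t x).congr_dist ?_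
  have hsq : Tendsto (fun n : ℕ => (√(n : ℝ))⁻¹) atTop (𝓝 0) :=
    tendsto_inv_atTop_zero.comp (Real.tendsto_sqrt_atTop.comp tendsto_natCast_atTop_atTop)
  refine squeeze_zero (g := fun n : ℕ => |(√(n : ℝ))⁻¹ * s| + |(√(n : ℝ))⁻¹ * t|)
    (fun _ => dist_nonneg) (fun n => ?_) ?_
  · rw [dist_comm, dist_eq_norm, ← integral_sub]
    · refine (norm_integral_le_of_norm_le_const (C := |(√(n : ℝ))⁻¹ * s| + |(√(n : ℝ))⁻¹ * t|)
        (ae_of_all _ fun X => ?_)).trans_eq ?_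
      · exact norm_exp_sub_exp_harmonic_le _ _ (X n)
      · rw [probReal_univ, mul_one]
    · exact integrable_comp_eval (fun y => cexp ((((√(n : ℝ))⁻¹ * s * y.1 +
        (√(n : ℝ))⁻¹ * t * y.2 : ℝ) : ℂ) * I)) n x
    · exact integrable_comp_eval (fun y => cexp ((((√(n : ℝ))⁻¹ * s * harmonicFst y +
        (√(n : ℝ))⁻¹ * t * harmonicSnd y : ℝ) : ℂ) * I)) n x
  · simpa using ((hsq.mul_const s).abs).add ((hsq.mul_const t).abs)

lemma isNondegenerateCenteredGaussian_stdGaussian :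
    IsNondegenerateCenteredGaussian (stdGaussian (EuclideanSpace ℝ (Fin 2))) where
  isGaussian := inferInstance
  centered := integral_id_stdGaussian
  nondegenerate u hu := by
    have h := variance_dual_stdGaussian (E := EuclideanSpace ℝ (Fin 2)) (innerSL ℝ u)
    change 0 < Var[innerSL ℝ u; stdGaussian (EuclideanSpace ℝ (Fin 2))]
    rw [h, innerSL_apply_norm]
    exact pow_pos (norm_pos_iff.2 hu) 2

lemma measurable_smul_toPlane_eval (n : ℕ) :
    Measurable fun X : ℕ → ℤ × ℤ => (√(n : ℝ))⁻¹ • toPlane (X n) :=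
  (Measurable.of_discrete (f := fun y : ℤ × ℤ => (√(n : ℝ))⁻¹ • toPlane y)).comp
    (measurable_pi_apply n)

lemma satisfiesCLT_manhattan : SatisfiesCLT (chainLaw manhattanStep) := by
  refine ⟨isDiffusive_manhattan, stdGaussian _, inferInstance,
    isNondegenerateCenteredGaussian_stdGaussian, fun x => ?_⟩
  refine ⟨fun n => (measurable_smul_toPlane_eval n).aemeasurable, aemeasurable_id, ?_⟩
  -- Lévy's continuity theorem.
  refine ProbabilityMeasure.tendsto_of_tendsto_charFun fun t => ?_
  simp only [ProbabilityMeasure.coe_mk, Measure.map_id']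
  rw [charFun_stdGaussian]
  have h := tendsto_integral_exp_coord (t 0) (t 1) x
  have e : ((Real.exp (-((t 0 ^ 2 + t 1 ^ 2) / 2)) : ℝ) : ℂ) =
      Complex.exp (-(‖t‖ : ℂ) ^ 2 / 2) := by
    have hn : ‖t‖ ^ 2 = t 0 ^ 2 + t 1 ^ 2 := by simp [EuclideanSpace.norm_sq_eq]
    rw [← hn]
    push_cast
    congr 1
    ring
  rw [e] at h
  refine h.congr fun n => ?_
  rw [charFun_apply, integral_map (measurable_smul_toPlane_eval n).aemeasurable (by fun_prop)]
  refine integral_congr_ae (ae_of_all _ fun X => ?_)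
  simp only [toPlane, PiLp.inner_apply, Fin.sum_univ_two]
  congr 3
  simp
  ring

end CharacteristicFunction

/-! ### Return probabilities of the simple walk on ℤ. -/

section SimpleWalkOnIntegers

/-- The probability that the simple random walk on `ℤ` started at `0` is at `k` after `n` steps. -/
noncomputable def walkProb : ℕ → ℤ → ℝ
  | 0, k => if k = 0 then 1 else 0
  | n + 1, k => 2⁻¹ * (walkProb n (k - 1) + walkProb n (k + 1))

lemma walkProb_succ (n : ℕ) (k : ℤ) :
    walkProb (n + 1) k = 2⁻¹ * (walkProb n (k - 1) + walkProb n (k + 1)) := rfl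

lemma walkProb_neg (n : ℕ) (k : ℤ) : walkProb n (-k) = walkProb n k := by
  induction n generalizing k with
  | zero => simp [walkProb]
  | succ n ih =>
    rw [walkProb, walkProb, ← ih (k - 1), ← ih (k + 1), neg_sub', neg_add', add_comm]
    simp

lemma walkProb_eq_zero {n : ℕ} {k : ℤ} (h : k < -n) : walkProb n k = 0 := by
  induction n generalizing k with
  | zero => exact if_neg (by lia)
  | succ n ih => rw [walkProb, ih (by push_cast at h; lia), ih (by push_cast at h; lia)]; simp

lemma walkProb_eq_choose (n i : ℕ) : walkProb n (2 * i - n) = n.choose i / 2 ^ n := by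
  induction n generalizing i with
  | zero => cases i <;> simp [walkProb]; lia
  | succ n ih =>
    have h1 : (2 * i - (n + 1 : ℕ) + 1 : ℤ) = 2 * i - n := by push_cast; ring
    rw [walkProb, h1, ih i]
    cases i with
    | zero => rw [walkProb_eq_zero (by push_cast; lia)]; simp; ring
    | succ i =>
      have h2 : (2 * (i + 1 : ℕ) - (n + 1 : ℕ) - 1 : ℤ) = 2 * i - n := by push_cast; ring
      rw [h2, ih i, Nat.choose_succ_succ]
      push_cast
      ring

lemma walkProb_two_mul (m : ℕ) : walkProb (2 * m) 0 = m.centralBinom / 4 ^ m := by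
  have h := walkProb_eq_choose (2 * m) m
  rw [show (2 * (m : ℤ) - (2 * m : ℕ)) = 0 by push_cast; ring] at h
  rw [h, pow_mul, Nat.centralBinom]
  norm_num

lemma walkProb_two_mul_succ (m : ℕ) :
    walkProb (2 * (m + 1)) 0 = walkProb (2 * m) 0 * ((2 * m + 1) / (2 * m + 2)) := by
  have h : ((m + 1 : ℕ) : ℝ) * (m + 1).centralBinom = 2 * (2 * m + 1) * m.centralBinom := by
    exact_mod_cast Nat.succ_mul_centralBinom_succ m
  rw [walkProb_two_mul, walkProb_two_mul, pow_succ]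
  push_cast at h
  field_simp
  linarith

/-- A lower bound for the return probabilities of the simple random walk on `ℤ`. -/
lemma le_sq_walkProb (m : ℕ) :
    1 / (4 * (m + 1 : ℝ)) ≤ walkProb (2 * (m + 1)) 0 ^ 2 := by
  induction m with
  | zero => rw [walkProb_two_mul]; norm_num [Nat.centralBinom]
  -- The induction needs ((2m + 3)/(2m + 4))² ≥ (m + 1)/(m + 2), that is, (2m + 3)² ≥ 4(m + 1)(m +
  -- 2).
  | succ m ih =>
    rw [walkProb_two_mul_succ, mul_pow]
    refine le_trans ?_ (mul_le_mul_of_nonneg_right ih (sq_nonneg _))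
    push_cast
    rw [div_pow, div_mul_div_comm, div_le_div_iff₀ (by positivity) (by positivity)]
    nlinarith [sq_nonneg (m : ℝ), m.cast_nonneg (α := ℝ)]

end SimpleWalkOnIntegers

/-! ### Diagonal coordinates and return probabilities in the plane. -/

section ReturnProbabilities

/-- The probability that the walk on the Manhattan lattice from `x` is at `y` after `n` steps. -/
noncomputable def manhattanProb (n : ℕ) (x y : ℤ × ℤ) : ℝ :=
  (chainLaw manhattanStep x).real {X | X n = y}

lemma manhattanProb_zero (x y : ℤ × ℤ) : manhattanProb 0 x y = if x = y then 1 else 0 := by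
  have h := integral_comp_eval_zero (fun z : ℤ × ℤ => if z = y then (1 : ℝ) else 0) x
  rw [← h, manhattanProb, ← integral_indicator_one (measurableSet_eval_eq 0 y)]
  simp [Set.indicator_apply]

lemma manhattanProb_succ (n : ℕ) (x y : ℤ × ℤ) :
    manhattanProb (n + 1) x y =
      2⁻¹ * manhattanProb n (moveHorizontal x) y + 2⁻¹ * manhattanProb n (moveVertical x) y := by
  have e : ∀ n x, manhattanProb n x y =
      ∫ X, (if X n = y then (1 : ℝ) else 0) ∂chainLaw manhattanStep x := by
    intro n x
    rw [manhattanProb, ← integral_indicator_one (measurableSet_eval_eq n y)]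
    simp [Set.indicator_apply]
  rw [e, e, e]
  exact integral_comp_eval_succ (fun z : ℤ × ℤ => if z = y then (1 : ℝ) else 0) n x

/-- The coordinates in which two steps of the walk started at a point with even coordinate sum are
two independent fair signs: here the sum of the first signs. -/
def diagFst (x : ℤ × ℤ) : ℤ := (x.1 - x.2) / 2

/-- The sum of the second signs, for the two-step walk described at `diagFst`. -/
def diagSnd (x : ℤ × ℤ) : ℤ := (x.1 + x.2 + dirSign x.1 - 1) / 2

/-- For an even coordinate sum both divisions by 2 are exact: `diagFst` is (h¹ - h²)/2 and `diagSnd`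
is (h¹ + h² - 1)/2. The sign is the parity bit needed to recover x from h. -/
lemma eq_iff_diag_eq {x y : ℤ × ℤ} (hx : Even (x.1 + x.2)) (hy : Even (y.1 + y.2)) :
    x = y ↔ diagFst x = diagFst y ∧ diagSnd x = diagSnd y ∧ dirSign x.1 = dirSign y.1 := by
  refine ⟨fun h => by simp [h], fun ⟨h1, h2, h3⟩ => ?_⟩
  rw [Int.even_iff] at hx hy
  simp only [diagFst, diagSnd, dirSign_eq_emod] at h1 h2 h3
  exact Prod.ext (by lia) (by lia)

/-- In this and the three companion lemmas, the new `dirSign z.1` equals the increment of `diagSnd`.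
The parity bit is thus the latest second sign. -/
lemma diag_moveHorizontal_twice {x : ℤ × ℤ} (hx : Even (x.1 + x.2)) :
    let z := moveHorizontal (moveHorizontal x)
    Even (z.1 + z.2) ∧ diagFst z = diagFst x + dirSign x.1 ∧
      diagSnd z = diagSnd x + dirSign x.1 ∧ dirSign z.1 = dirSign x.1 := by
  simp only [Int.even_iff, moveHorizontal, diagFst, diagSnd, dirSign_eq_emod] at hx ⊢
  lia

lemma diag_moveVertical_moveHorizontal {x : ℤ × ℤ} (hx : Even (x.1 + x.2)) :
    let z := moveVertical (moveHorizontal x)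
    Even (z.1 + z.2) ∧ diagFst z = diagFst x + dirSign x.1 ∧
      diagSnd z = diagSnd x - dirSign x.1 ∧ dirSign z.1 = -dirSign x.1 := by
  simp only [Int.even_iff, moveHorizontal, moveVertical, diagFst, diagSnd,
    dirSign_eq_emod] at hx ⊢
  lia

lemma diag_moveHorizontal_moveVertical {x : ℤ × ℤ} (hx : Even (x.1 + x.2)) :
    let z := moveHorizontal (moveVertical x)
    Even (z.1 + z.2) ∧ diagFst z = diagFst x - dirSign x.1 ∧
      diagSnd z = diagSnd x - dirSign x.1 ∧ dirSign z.1 = -dirSign x.1 := by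
  simp only [Int.even_iff, moveHorizontal, moveVertical, diagFst, diagSnd,
    dirSign_eq_emod] at hx ⊢
  lia

lemma diag_moveVertical_twice {x : ℤ × ℤ} (hx : Even (x.1 + x.2)) :
    let z := moveVertical (moveVertical x)
    Even (z.1 + z.2) ∧ diagFst z = diagFst x - dirSign x.1 ∧
      diagSnd z = diagSnd x + dirSign x.1 ∧ dirSign z.1 = dirSign x.1 := by
  simp only [Int.even_iff, moveVertical, diagFst, diagSnd, dirSign_eq_emod] at hx ⊢
  lia

lemma manhattanProb_add_two {n : ℕ} {y : ℤ × ℤ} (F : ℤ → ℤ → ℤ → ℝ)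
    (hF : ∀ z : ℤ × ℤ, Even (z.1 + z.2) →
      manhattanProb n z y = F (diagFst z) (diagSnd z) (dirSign z.1))
    {x : ℤ × ℤ} (hx : Even (x.1 + x.2)) :
    manhattanProb (n + 2) x y =
      4⁻¹ * (F (diagFst x + 1) (diagSnd x + 1) 1 + F (diagFst x + 1) (diagSnd x - 1) (-1) +
        F (diagFst x - 1) (diagSnd x + 1) 1 + F (diagFst x - 1) (diagSnd x - 1) (-1)) := by
  obtain ⟨hhe, hha, hhb, hhs⟩ := diag_moveHorizontal_twice hx
  obtain ⟨hve, hva, hvb, hvs⟩ := diag_moveVertical_moveHorizontal hx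
  obtain ⟨vhe, vha, vhb, vhs⟩ := diag_moveHorizontal_moveVertical hx
  obtain ⟨vve, vva, vvb, vvs⟩ := diag_moveVertical_twice hx
  rw [manhattanProb_succ, manhattanProb_succ, manhattanProb_succ, hF _ hhe, hF _ hve, hF _ vhe,
    hF _ vve, hha, hhb, hhs, hva, hvb, hvs, vha, vhb, vhs, vva, vvb, vvs]
  rcases dirSign_eq_one_or x.1 with h | h <;> rw [h]
  · ring
  · simp only [sub_neg_eq_add, neg_neg, ← sub_eq_add_neg]
    ring

/-- After an even positive number of steps, the walk started at a point with even coordinate sum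
is described by two independent simple random walks, the last sign of the second one giving the
parity of the coordinates. -/
lemma manhattanProb_two_mul_succ (j : ℕ) {x y : ℤ × ℤ} (hx : Even (x.1 + x.2))
    (hy : Even (y.1 + y.2)) :
    manhattanProb (2 * (j + 1)) x y =
      walkProb (j + 1) (diagFst y - diagFst x) *
        (2⁻¹ * walkProb j (diagSnd y - diagSnd x - dirSign y.1)) := by
  induction j generalizing x with
  | zero =>
    rw [show 2 * (0 + 1) = 0 + 2 by rfl,
      manhattanProb_add_two (fun a b s => if a = diagFst y ∧ b = diagSnd y ∧ s = dirSign y.1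
        then 1 else 0) (fun z hz => by
          rw [manhattanProb_zero]; exact if_congr (eq_iff_diag_eq hz hy) rfl rfl) hx]
    simp only [walkProb]
    rcases dirSign_eq_one_or y.1 with h | h <;> rw [h]
    · have e1 : diagFst y - diagFst x - 1 = 0 ↔ diagFst x + 1 = diagFst y := by lia
      have e2 : diagFst y - diagFst x + 1 = 0 ↔ diagFst x - 1 = diagFst y := by lia
      have e3 : diagSnd y - diagSnd x - 1 = 0 ↔ diagSnd x + 1 = diagSnd y := by lia
      simp only [e1, e2, e3, ite_and]
      split_ifs <;> norm_num at *
    · have e1 : diagFst y - diagFst x - 1 = 0 ↔ diagFst x + 1 = diagFst y := by lia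
      have e2 : diagFst y - diagFst x + 1 = 0 ↔ diagFst x - 1 = diagFst y := by lia
      have e3 : diagSnd y - diagSnd x - -1 = 0 ↔ diagSnd x - 1 = diagSnd y := by lia
      simp only [e1, e2, e3, ite_and]
      split_ifs <;> norm_num at *
  | succ j ih =>
    rw [show 2 * (j + 1 + 1) = 2 * (j + 1) + 2 by ring,
      -- This `F` ignores its third argument: with at least two steps left, the current parity bit
      -- will be overwritten.
      manhattanProb_add_two (fun a b _ => walkProb (j + 1) (diagFst y - a) *
        (2⁻¹ * walkProb j (diagSnd y - b - dirSign y.1))) (fun z hz => ih hz) hx,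
      walkProb_succ (j + 1), walkProb_succ j (diagSnd y - diagSnd x - dirSign y.1)]
    have e1 : diagFst y - (diagFst x + 1) = diagFst y - diagFst x - 1 := by ring
    have e2 : diagFst y - (diagFst x - 1) = diagFst y - diagFst x + 1 := by ring
    have e3 : diagSnd y - (diagSnd x + 1) - dirSign y.1 =
      diagSnd y - diagSnd x - dirSign y.1 - 1 := by ring
    have e4 : diagSnd y - (diagSnd x - 1) - dirSign y.1 =
      diagSnd y - diagSnd x - dirSign y.1 + 1 := by ring
    rw [e1, e2, e3, e4]
    ring

lemma le_manhattanProb_of_even (m : ℕ) {x : ℤ × ℤ} (hx : Even (x.1 + x.2)) :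
    1 / (8 * (m + 1 : ℝ)) ≤ manhattanProb (4 * (m + 1)) x x := by
  have h := manhattanProb_two_mul_succ (2 * m + 1) hx hx
  -- By symmetry, being at either of ±1 at time 2m + 1 is as likely as being at 0 one step later, so
  -- the return probability is half a square.
  have hs : 2⁻¹ * walkProb (2 * m + 1) (diagSnd x - diagSnd x - dirSign x.1) =
      2⁻¹ * walkProb (2 * (m + 1)) 0 := by
    have h1 : walkProb (2 * m + 1) (diagSnd x - diagSnd x - dirSign x.1) =
        walkProb (2 * m + 1) 1 := by
      rw [sub_self, zero_sub, walkProb_neg]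
      rcases dirSign_eq_one_or x.1 with h | h <;> rw [h]
      exact walkProb_neg _ 1
    rw [h1, show 2 * (m + 1) = 2 * m + 1 + 1 by ring, walkProb_succ (2 * m + 1), zero_sub,
      walkProb_neg, zero_add]
    ring
  rw [hs, sub_self, show 2 * m + 1 + 1 = 2 * (m + 1) by ring,
    show 2 * (2 * (m + 1)) = 4 * (m + 1) by ring] at h
  rw [h]
  calc 1 / (8 * (m + 1 : ℝ)) = 2⁻¹ * (1 / (4 * (m + 1))) := by field_simp; norm_num
    _ ≤ 2⁻¹ * walkProb (2 * (m + 1)) 0 ^ 2 := by gcongr; exact le_sq_walkProb m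
    _ = _ := by ring

/-- An automorphism of the Manhattan lattice that exchanges the two parities of the coordinate
sum. -/
def reflectShift (x : ℤ × ℤ) : ℤ × ℤ := (-x.1, x.2 + 1)

lemma reflectShift_injective : Function.Injective reflectShift := by
  intro x y h
  simp only [reflectShift, Prod.mk.injEq] at h
  exact Prod.ext (by lia) (by lia)

/-- The reflection reverses horizontal edges and the shift by one row reverses them again. -/
lemma moveHorizontal_reflectShift (x : ℤ × ℤ) :
    moveHorizontal (reflectShift x) = reflectShift (moveHorizontal x) := by
  simp only [moveHorizontal, reflectShift, dirSign_add_one, neg_add]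

lemma moveVertical_reflectShift (x : ℤ × ℤ) :
    moveVertical (reflectShift x) = reflectShift (moveVertical x) := by
  simp only [moveVertical, reflectShift, dirSign_neg, add_right_comm]

lemma manhattanProb_reflectShift (n : ℕ) (x y : ℤ × ℤ) :
    manhattanProb n (reflectShift x) (reflectShift y) = manhattanProb n x y := by
  induction n generalizing x with
  | zero => simp only [manhattanProb_zero, reflectShift_injective.eq_iff]
  | succ n ih =>
    rw [manhattanProb_succ, manhattanProb_succ, moveHorizontal_reflectShift,
      moveVertical_reflectShift, ih, ih]

lemma le_manhattanProb (m : ℕ) (x : ℤ × ℤ) :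
    1 / (8 * (m + 1 : ℝ)) ≤ manhattanProb (4 * (m + 1)) x x := by
  rcases Int.even_or_odd (x.1 + x.2) with h | h
  · exact le_manhattanProb_of_even m h
  · rw [← manhattanProb_reflectShift]
    refine le_manhattanProb_of_even m ?_
    simp only [reflectShift]
    rw [Int.odd_iff] at h
    rw [Int.even_iff]
    lia

lemma not_summable_manhattanProb (x : ℤ × ℤ) : ¬ Summable fun n => manhattanProb n x x := by
  intro h
  have h1 : Summable fun m : ℕ => manhattanProb (4 * (m + 1)) x x :=
    h.comp_injective (i := fun m : ℕ => 4 * (m + 1)) fun a b hab => by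
      have : 4 * (a + 1) = 4 * (b + 1) := hab
      lia
  have h2 : Summable fun m : ℕ => 8⁻¹ * (1 / ((m + 1 : ℕ) : ℝ)) :=
    Summable.of_nonneg_of_le (fun m => by positivity) (fun m => by
      refine le_trans (le_of_eq ?_) (le_manhattanProb m x)
      push_cast
      field_simp) h1
  rw [summable_mul_left_iff (by norm_num)] at h2
  exact Real.not_summable_one_div_natCast ((summable_nat_add_iff 1).1 h2)

end ReturnProbabilities

/-! ### Recurrence from divergence of the return probabilities. -/

section Recurrence

/-- If the return probabilities of a Markov chain are not summable, then it returns to its starting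
point. -/
lemma chainLaw_return_eq_one {V : Type*} [MeasurableSpace V] [Countable V]
    [DiscreteMeasurableSpace V] (step : V → PMF V) (x : V)
    (h : ¬ Summable fun n => (chainLaw step x).real {X | X n = x}) :
    chainLaw step x {X | ∃ n : ℕ, 0 < n ∧ X n = x ∧ X 0 = x} = 1 := by
  set R : Set (ℕ → V) := {X | ∀ n, 0 < n → X n ≠ x}
  have hR : MeasurableSet R := by
    have : R = ⋂ n : ℕ, ⋂ _ : 0 < n, {X | X n = x}ᶜ := by
      ext; simp [R]
    rw [this]
    exact MeasurableSet.iInter fun n => MeasurableSet.iInter fun _ =>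
      (measurableSet_eval_eq n x).compl
  have hzero : chainLaw step x R = 0 := by
    by_contra hne
    apply h
    -- `L n` says that the last visit to `x` is at time `n`. These events are disjoint, and by the
    -- Markov property each has probability P(X_n = x) · P(R).
    set L : ℕ → Set (ℕ → V) := fun n => {X | X n = x ∧ (fun k => X (n + k)) ∈ R}
    have hL : ∀ n, MeasurableSet (L n) := fun n =>
      (measurableSet_eval_eq n x).inter 
        (measurableSet_preimage (f := fun (X : ℕ → V) k => X (n + k))
          (measurable_pi_iff.2 fun k => measurable_pi_apply (n + k)) hR)
    have hdisj : Pairwise fun i j => Disjoint (L i) (L j) := by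
      have key : ∀ i j, i < j → Disjoint (L i) (L j) := by
        intro i j hij
        rw [Set.disjoint_left]
        rintro X ⟨-, hX⟩ ⟨hj, -⟩
        refine hX (j - i) (by lia) ?_
        change X (i + (j - i)) = x
        rwa [Nat.add_sub_cancel' hij.le]
      intro i j hij
      rcases lt_or_gt_of_ne hij with h | h
      · exact key i j h
      · exact (key j i h).symm
    have hsum : (∑' n, chainLaw step x {X | X n = x}) * chainLaw step x R ≤ 1 := by
      rw [← ENNReal.tsum_mul_right]
      simp_rw [← chainLaw_markov step x hR]
      rw [← measure_iUnion hdisj hL]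
      exact prob_le_one
    refine ENNReal.summable_toReal fun htop => ?_
    rw [htop, ENNReal.top_mul hne] at hsum
    exact absurd hsum (by simp)
  rw [measure_eq_zero_iff_ae_notMem] at hzero
  refine le_antisymm prob_le_one ?_
  rw [← measure_univ (μ := chainLaw step x)]
  refine measure_mono_ae ?_
  filter_upwards [hzero, ae_eval_zero step x] with X hX h0 _
  simp only [R, Set.mem_ofPred_eq, not_forall, not_not, exists_prop] at hX
  obtain ⟨n, hn, hXn⟩ := hX
  exact ⟨n, hn, hXn, h0⟩

lemma isRecurrent_manhattan : IsRecurrent (chainLaw manhattanStep) := fun x =>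
  chainLaw_return_eq_one manhattanStep x (not_summable_manhattanProb x)

end Recurrence

/-! ### The block process at even times. -/

section BlockProcess

lemma tsum_simpleStep_mul (x : ℤ × ℤ) (f : ℤ × ℤ → ℝ≥0∞) :
    ∑' y, simpleStep x y * f y =
      4⁻¹ * (f (x.1 + 1, x.2) + f (x.1 - 1, x.2) + f (x.1, x.2 + 1) + f (x.1, x.2 - 1)) := by
  have hval : ∀ y, simpleStep x y = if |y.1 - x.1| + |y.2 - x.2| = 1 then 4⁻¹ else 0 := by
    intro y
    rw [← one_div]
    rfl
  rw [tsum_eq_sum (s := {(x.1 + 1, x.2), (x.1 - 1, x.2), (x.1, x.2 + 1), (x.1, x.2 - 1)})]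
  · rw [Finset.sum_insert (by simp; lia), Finset.sum_insert (by simp),
      Finset.sum_insert (by simp; lia), Finset.sum_singleton]
    simp only [hval]
    simp
    ring
  · rintro ⟨a, b⟩ hy
    simp only [Finset.mem_insert, Finset.mem_singleton, Prod.mk.injEq] at hy
    rw [hval, if_neg, zero_mul]
    intro h
    apply hy
    simp only at h
    rcases abs_cases (a - x.1) with h1 | h1 <;> rcases abs_cases (b - x.2) with h2 | h2 <;> lia

/-- The process of the blocks visited at even times. -/
def blockPath (X : ℕ → ℤ × ℤ) : ℕ → ℤ × ℤ := fun n => block (X (2 * n))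

lemma measurable_blockPath : Measurable blockPath :=
  measurable_pi_iff.2 fun n =>
    (Measurable.of_discrete (f := block)).comp (measurable_pi_apply (2 * n))

lemma blockPath_consPath_consPath (x y : ℤ × ℤ) (X : ℕ → ℤ × ℤ) :
    blockPath (consPath x (consPath y X)) = consPath (block x) (blockPath X) := by
  funext n
  cases n <;> rfl

/-- Two steps of the walk on the Manhattan lattice started at a point with even coordinate sum
move its block to a uniformly chosen neighbour. -/
lemma sum_block_neighbours {x : ℤ × ℤ} (hx : Even (x.1 + x.2)) (f : ℤ × ℤ → ℝ≥0∞) :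
    2⁻¹ * (2⁻¹ * f (block (moveHorizontal (moveHorizontal x))) +
        2⁻¹ * f (block (moveVertical (moveHorizontal x)))) +
      2⁻¹ * (2⁻¹ * f (block (moveHorizontal (moveVertical x))) +
        2⁻¹ * f (block (moveVertical (moveVertical x)))) =
      4⁻¹ * (f ((block x).1 + 1, (block x).2) + f ((block x).1 - 1, (block x).2) +
        f ((block x).1, (block x).2 + 1) + f ((block x).1, (block x).2 - 1)) := by
  have h4 : (2⁻¹ : ℝ≥0∞) * 2⁻¹ = 4⁻¹ := by
    rw [← ENNReal.mul_inv (by simp) (by simp)]; norm_num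
  have hblock : ∀ {y : ℤ × ℤ} {a b : ℤ}, y.1 / 2 = a → y.2 / 2 = b → block y = (a, b) := by
    rintro y a b rfl rfl; rfl
  simp only [mul_add, ← mul_assoc, h4]
  rw [Int.even_iff] at hx
  -- A block contains two points with even sum, one with both coordinates even and one with both
  -- odd; the same two moves lead to opposite neighbours from these.
  rcases Int.emod_two_eq_zero_or_one x.1 with h | h
  · rw [hblock (y := moveHorizontal (moveHorizontal x)) (a := (block x).1 + 1) (b := (block x).2),
      hblock (y := moveVertical (moveHorizontal x)) (a := (block x).1) (b := (block x).2 - 1),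
      hblock (y := moveHorizontal (moveVertical x)) (a := (block x).1 - 1) (b := (block x).2),
      hblock (y := moveVertical (moveVertical x)) (a := (block x).1) (b := (block x).2 + 1)]
    · ring
    all_goals simp only [moveHorizontal, moveVertical, block, dirSign_eq_emod] <;> lia
  · rw [hblock (y := moveHorizontal (moveHorizontal x)) (a := (block x).1 - 1) (b := (block x).2),
      hblock (y := moveVertical (moveHorizontal x)) (a := (block x).1) (b := (block x).2 + 1),
      hblock (y := moveHorizontal (moveVertical x)) (a := (block x).1 + 1) (b := (block x).2),
      hblock (y := moveVertical (moveVertical x)) (a := (block x).1) (b := (block x).2 - 1)]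
    · ring
    all_goals simp only [moveHorizontal, moveVertical, block, dirSign_eq_emod] <;> lia

lemma manhattan_blockPath_preimage (x : ℤ × ℤ) {C : Set (ℕ → ℤ × ℤ)} (hC : MeasurableSet C) :
    chainLaw manhattanStep x (blockPath ⁻¹' C) =
      2⁻¹ * (2⁻¹ * chainLaw manhattanStep (moveHorizontal (moveHorizontal x))
          (blockPath ⁻¹' (consPath (block x) ⁻¹' C)) +
        2⁻¹ * chainLaw manhattanStep (moveVertical (moveHorizontal x))
          (blockPath ⁻¹' (consPath (block x) ⁻¹' C))) +
      2⁻¹ * (2⁻¹ * chainLaw manhattanStep (moveHorizontal (moveVertical x))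
          (blockPath ⁻¹' (consPath (block x) ⁻¹' C)) +
        2⁻¹ * chainLaw manhattanStep (moveVertical (moveVertical x))
          (blockPath ⁻¹' (consPath (block x) ⁻¹' C))) := by
  have hB := measurable_blockPath hC
  -- The position at the odd time is invisible to `blockPath`.
  have e : ∀ y, consPath y ⁻¹' (consPath x ⁻¹' (blockPath ⁻¹' C)) =
      blockPath ⁻¹' (consPath (block x) ⁻¹' C) := by
    intro y
    ext X
    simp only [Set.mem_preimage, blockPath_consPath_consPath]
  rw [manhattan_apply x hB, manhattan_apply _ (measurable_consPath x hB),
    manhattan_apply _ (measurable_consPath x hB), e, e]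

/-- Recursion on `n` over all starting points with even sum: the next block is uniform among the
neighbours whichever such point of the block is occupied, so forgetting the point loses nothing. -/
lemma manhattan_blockPath_pathCylinder (n : ℕ) (w : ℕ → ℤ × ℤ) {x : ℤ × ℤ}
    (hx : Even (x.1 + x.2)) :
    chainLaw manhattanStep x (blockPath ⁻¹' pathCylinder n w) =
      chainLaw simpleStep (block x) (pathCylinder n w) := by
  have key : ∀ z : ℤ × ℤ, Even (z.1 + z.2) →
      chainLaw manhattanStep z (blockPath ⁻¹' (consPath (block x) ⁻¹' pathCylinder n w)) =
        chainLaw simpleStep (block z) (consPath (block x) ⁻¹' pathCylinder n w) := by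
    intro z hz
    by_cases h : block x = w 0
    · cases n with
      | zero =>
        have : consPath (block x) ⁻¹' pathCylinder 0 w = Set.univ := by
          ext; simp [pathCylinder, h]
        simp [this]
      | succ n =>
        have : consPath (block x) ⁻¹' pathCylinder (n + 1) w =
            pathCylinder n fun i => w (i + 1) := by
          ext; simp [consPath_mem_pathCylinder_succ, h]
        rw [this, manhattan_blockPath_pathCylinder n _ hz]
    · have : consPath (block x) ⁻¹' pathCylinder n w = ∅ := by
        ext X
        simp only [Set.mem_preimage, Set.mem_empty_iff_false, iff_false]
        exact fun hX => h (hX 0 (Nat.zero_le n))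
      simp [this]
  rw [manhattan_blockPath_preimage x (measurableSet_pathCylinder n w),
    key _ (diag_moveHorizontal_twice hx).1, key _ (diag_moveVertical_moveHorizontal hx).1,
    key _ (diag_moveHorizontal_moveVertical hx).1, key _ (diag_moveVertical_twice hx).1,
    chainLaw_apply simpleStep _ (measurableSet_pathCylinder n w), tsum_simpleStep_mul]
  exact sum_block_neighbours hx
    fun b => chainLaw simpleStep b (consPath (block x) ⁻¹' pathCylinder n w)

lemma map_blockPath_manhattan {x : ℤ × ℤ} (hx : Even (x.1 + x.2)) :
    (chainLaw manhattanStep x).map blockPath = chainLaw simpleStep (block x) := by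
  have := Measure.isProbabilityMeasure_map (μ := chainLaw manhattanStep x)
    measurable_blockPath.aemeasurable
  refine ext_of_pathCylinder fun n w => ?_
  rw [Measure.map_apply measurable_blockPath (measurableSet_pathCylinder n w),
    manhattan_blockPath_pathCylinder n w hx]

end BlockProcess

theorem mainTheorem8 :
    SatisfiesCLT (chainLaw manhattanStep) ∧
    IsRecurrent (chainLaw manhattanStep) ∧
    (chainLaw manhattanStep (0, 0)).map (fun X n => block (X (2 * n))) =
      chainLaw simpleStep (0, 0) :=
  ⟨satisfiesCLT_manhattan, isRecurrent_manhattan,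
    map_blockPath_manhattan (x := (0, 0)) (by simp)⟩
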